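/- Let $q$ be a prime power, let $m,n$ be positive integers, and let $\mathcal C\subseteq \mathrm{Mat}_{n\times m}(\mathbb F_q)$ be a rank-metric code, i.e. an $\mathbb F_q$-linear subspace; all dimensions are over $\mathbb F_q$. Let $\mathcal C^{\mathsf T}=\{M^{\mathsf T}\mid M\in\mathcal C\}\subseteq \mathrm{Mat}_{m\times n}(\mathbb F_q)$. A subspace $\mathcal A\subseteq \mathrm{Mat}_{n\times m}(\mathbb F_q)$ is an *optimal anticode* if $\dim(\mathcal A)=\max\{n,m\}\cdot\max\{\mathrm{rk}(M)\mid M\in\mathcal A\}$. For $i=1,\ldots,\dim(\mathcal C)$, the $i$-th *generalized weight* of $\mathcal C$ is $$d_i(\mathcal C)=\frac{1}{\max\{m,n\}}\min\{\dim(\mathcal A)\mid \mathcal A\subseteq \mathrm{Mat}_{n\times m}(\mathbb F_q)\text{ an optimal anticode},\ \dim(\mathcal C\cap\mathcal A)\ge i\}.$$ For any positive integers $a,b$, any subspace $\mathcal D\subseteq \mathrm{Mat}_{a\times b}(\mathbb F_q)$ and $i=1,\ldots,\dim(\mathcal D)$, the $i$-th *generalized matrix weight* of $\mathcal D$ is $$\delta_i(\mathcal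 D)=\min\{\dim(V)\mid V\subseteq\mathbb F_q^a\text{ a subspace},\ \dim\{M\in\mathcal D\mid \mathrm{colsp}(M)\subseteq V\}\ge i\},$$ where $\mathrm{colsp}(M)\subseteq\mathbb F_q^a$ is the space generated by the columns of $M$. Theorem. 1. If $m<n$, then $d_i(\mathcal C)=\delta_i(\mathcal C^{\mathsf T})$ for $i=1,\ldots,\dim(\mathcal C)$. 2. If $m=n$, then $d_i(\mathcal C)=\min\{\delta_i(\mathcal C),\delta_i(\mathcal C^{\mathsf T})\}$ for $i=1,\ldots,\dim(\mathcal C)$. -/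

import Mathlib

namespace RankMetric

variable {F : Type*} [Field F] {n m : ℕ}

/-- The column space of `M`: the subspace of `F ^ n` generated by the columns of `M`. -/
def colSpace (M : Matrix (Fin n) (Fin m) F) : Submodule F (Fin n → F) :=
  Submodule.span F (Set.range fun (j : Fin m) (i : Fin n) => M i j)

/-- The space of all `n × m` matrices whose column space is contained in `V`. -/
def matColSupported (m : ℕ) (V : Submodule F (Fin n → F)) :
    Submodule F (Matrix (Fin n) (Fin m) F) where
  carrier := {M | colSpace M ≤ V}
  add_mem' := by
    intro A B hA hB
    refine Submodule.span_le.2 ?_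
    rintro _ ⟨j, rfl⟩
    exact V.add_mem (hA (Submodule.subset_span ⟨j, rfl⟩)) (hB (Submodule.subset_span ⟨j, rfl⟩))
  zero_mem' := by
    refine Submodule.span_le.2 ?_
    rintro _ ⟨j, rfl⟩
    exact V.zero_mem
  smul_mem' := by
    intro c A hA
    refine Submodule.span_le.2 ?_
    rintro _ ⟨j, rfl⟩
    exact V.smul_mem c (hA (Submodule.subset_span ⟨j, rfl⟩))

/-- The transposed code, consisting of the transposes of the elements of `C`. -/
def transposeCode (C : Submodule F (Matrix (Fin n) (Fin m) F)) :
    Submodule F (Matrix (Fin m) (Fin n) F) :=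
  C.map (Matrix.transposeLinearEquiv (Fin n) (Fin m) F F).toLinearMap

/-- The maximum rank of an element of the code `C` (see `isGreatest_maxRank`). -/
noncomputable def maxRank (C : Submodule F (Matrix (Fin n) (Fin m) F)) : ℕ :=
  sSup {r : ℕ | ∃ M ∈ C, M.rank = r}

/-- `C` is an optimal anticode: its dimension is `max {n, m}` times its maximum rank. -/
def IsOptimalAnticode (C : Submodule F (Matrix (Fin n) (Fin m) F)) : Prop :=
  Module.finrank F C = max n m * maxRank C

/-- The dimensions of the optimal anticodes that meet `C` in dimension at least `i`. -/
def anticodeDims (C : Submodule F (Matrix (Fin n) (Fin m) F)) (i : ℕ) : Set ℕ :=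
  {a : ℕ | ∃ A : Submodule F (Matrix (Fin n) (Fin m) F), IsOptimalAnticode A ∧
    i ≤ Module.finrank F (C ⊓ A : Submodule F (Matrix (Fin n) (Fin m) F)) ∧
    Module.finrank F A = a}

/-- The `i`-th generalized weight `d_i(C)`, for `1 ≤ i ≤ dim C`. The division takes place in `ℚ`;
the infimum is a minimum (see `isLeast_anticodeDims`). -/
noncomputable def genWeight (C : Submodule F (Matrix (Fin n) (Fin m) F)) (i : ℕ) : ℚ :=
  (1 / ((max n m : ℕ) : ℚ)) * ((sInf (anticodeDims C i) : ℕ) : ℚ)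

/-- The dimensions of the `V ⊆ F ^ n` such that the elements of `C` with column space contained
in `V` form a space of dimension at least `i`. -/
def supportDims (C : Submodule F (Matrix (Fin n) (Fin m) F)) (i : ℕ) : Set ℕ :=
  {v : ℕ | ∃ V : Submodule F (Fin n → F),
    i ≤ Module.finrank F
      (C ⊓ matColSupported m V : Submodule F (Matrix (Fin n) (Fin m) F)) ∧
    Module.finrank F V = v}

/-- The `i`-th generalized matrix weight `δ_i(C)`, for `1 ≤ i ≤ dim C`.
The infimum is a minimum (see `isLeast_supportDims`). -/
noncomputable def genMatrixWeight (C : Submodule F (Matrix (Fin n) (Fin m) F)) (i : ℕ) : ℕ :=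
  sInf (supportDims C i)

theorem isGreatest_maxRank (C : Submodule F (Matrix (Fin n) (Fin m) F)) :
    IsGreatest {r : ℕ | ∃ M ∈ C, M.rank = r} (maxRank C) := by
  have hb : BddAbove {r : ℕ | ∃ M ∈ C, M.rank = r} :=
    ⟨m, by rintro _ ⟨M, _, rfl⟩; exact M.rank_le_width⟩
  exact ⟨Nat.sSup_mem ⟨_, 0, C.zero_mem, rfl⟩ hb, fun r hr => le_csSup hb hr⟩

theorem isLeast_supportDims (C : Submodule F (Matrix (Fin n) (Fin m) F)) (i : ℕ)
    (hi : i ≤ Module.finrank F C) : IsLeast (supportDims C i) (genMatrixWeight C i) := by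
  have hne : (supportDims C i).Nonempty := by
    refine ⟨_, ⊤, ?_, rfl⟩
    have h : matColSupported m (⊤ : Submodule F (Fin n → F)) = ⊤ :=
      eq_top_iff.2 fun M _ => (le_top : colSpace M ≤ ⊤)
    rw [h, inf_top_eq]
    exact hi
  exact ⟨Nat.sInf_mem hne, fun a ha => Nat.sInf_le ha⟩

theorem isOptimalAnticode_top :
    IsOptimalAnticode (⊤ : Submodule F (Matrix (Fin n) (Fin m) F)) := by
  let M : Matrix (Fin n) (Fin m) F :=
    Matrix.of fun i j => if (i : ℕ) = (j : ℕ) then 1 else 0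
  have hM : min n m ≤ M.rank := by
    rcases le_total n m with h | h
    · have h1 : M * M.transpose = 1 := by
        ext i j
        rw [Matrix.mul_apply, Finset.sum_eq_single (Fin.castLE h i)]
        · simp [M, Matrix.transpose_apply, Matrix.one_apply, Fin.ext_iff, eq_comm]
        · intro k _ hk
          have : (i : ℕ) ≠ (k : ℕ) := fun e => hk (Fin.ext e.symm)
          simp [M, this]
        · simp
      have := Matrix.rank_mul_le_left M M.transpose
      rw [h1, Matrix.rank_one, Fintype.card_fin] at this
      exact (min_le_left _ _).trans this
    · have h1 : M.transpose * M = 1 := by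
        ext i j
        rw [Matrix.mul_apply, Finset.sum_eq_single (Fin.castLE h i)]
        · simp [M, Matrix.transpose_apply, Matrix.one_apply, Fin.ext_iff]
        · intro k _ hk
          have : (k : ℕ) ≠ (i : ℕ) := fun e => hk (Fin.ext e)
          simp [M, this]
        · simp
      have := Matrix.rank_mul_le_right M.transpose M
      rw [h1, Matrix.rank_one, Fintype.card_fin] at this
      exact (min_le_right _ _).trans this
  have hmax : maxRank (⊤ : Submodule F (Matrix (Fin n) (Fin m) F)) = min n m := by
    refine le_antisymm ?_ (hM.trans ((isGreatest_maxRank _).2 ⟨M, trivial, rfl⟩))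
    obtain ⟨A, _, hA⟩ := (isGreatest_maxRank (⊤ : Submodule F (Matrix (Fin n) (Fin m) F))).1
    rw [← hA]
    exact le_min A.rank_le_height A.rank_le_width
  rw [IsOptimalAnticode, hmax, finrank_top, Module.finrank_matrix]
  simp [max_mul_min]

theorem isLeast_anticodeDims (C : Submodule F (Matrix (Fin n) (Fin m) F)) (i : ℕ)
    (hi : i ≤ Module.finrank F C) : IsLeast (anticodeDims C i) (sInf (anticodeDims C i)) := by
  have hne : (anticodeDims C i).Nonempty :=
    ⟨_, ⊤, isOptimalAnticode_top, by rw [inf_top_eq]; exact hi, rfl⟩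
  exact ⟨Nat.sInf_mem hne, fun a ha => Nat.sInf_le ha⟩

end RankMetric

/-! The upper bounds on `genWeight` hold because, for `n ≤ m`, the matrices with column space inside
a fixed `V` form an optimal anticode of dimension `m * dim V`; transposition gives the case `m ≤ n`.
For the lower bounds, let `m ≤ n`. Every optimal anticode `A` of maximum rank `r` lies in a space of
matrices whose row space, or if `m = n` possibly whose column space, is confined to a subspace of
dimension at most `r` (`IsOptimalAnticode.exists_le`). Enlarging `A` to that space does not shrink
its intersection with the code.

This containment is the equality case of the bound `dim A ≤ r * n`, and the argument works over
every field. Matrices are read as tuples of `n` rows in `E = F ^ m`. The leading space at `p`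
consists of the entries at `p` of tuples of `A` vanishing before `p`; the dimensions of these spaces
add up to `dim A`. An independent transversal of leading spaces is realised by a tuple of `A`, hence
has at most `r` members. Counting then leaves two cases (`finrank_leadSpace_eq`).

If all leading spaces have dimension `r`, an exchange argument makes them one space `V`, and `V`
contains all rows. If `m = n`, `r` leading spaces are `E` and the others are zero, then the
remaining rows are fixed combinations of the `r` rows. In both cases a violation would allow a tuple
of rank `r + 1` to be built from left to right. -/

namespace RankMetric

/-! ### Subspaces and spanning tuples. -/

section LinearAlgebra

variable {F : Type*} [Field F] {E : Type*} [AddCommGroup E] [Module F E] [FiniteDimensional F E]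

/-- Subspaces of every intermediate dimension exist between two nested subspaces. -/
theorem exists_between_finrank_eq {K V : Submodule F E} (hKV : K ≤ V) {k : ℕ}
    (hk : Module.finrank F K ≤ k) (hkV : k ≤ Module.finrank F V) :
    ∃ L, K ≤ L ∧ L ≤ V ∧ Module.finrank F L = k := by
  induction k, hk using Nat.le_induction with
  | base => exact ⟨K, le_rfl, hKV, rfl⟩
  | succ k _ ih =>
    obtain ⟨L, h1, h2, h3⟩ := ih (by omega)
    obtain ⟨u, huV, huL⟩ : ∃ u ∈ V, u ∉ L := by
      by_contra! h
      have := Submodule.finrank_mono (show V ≤ L from h)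
      omega
    refine ⟨L ⊔ Submodule.span F {u}, h1.trans le_sup_left,
      sup_le h2 ((Submodule.span_singleton_le_iff_mem _ _).2 huV), ?_⟩
    rw [Submodule.finrank_sup_span_singleton huL, h3]

theorem exists_finrank_eq_mem_notMem {w z : E} (hw : w ≠ 0) (hz : z ∉ Submodule.span F {w})
    {k : ℕ} (hk : 1 ≤ k) (hkE : k < Module.finrank F E) :
    ∃ K : Submodule F E, w ∈ K ∧ z ∉ K ∧ Module.finrank F K = k := by
  have hz0 : z ≠ 0 := by rintro rfl; exact hz (zero_mem _)
  have hd : Disjoint (Submodule.span F {w}) (Submodule.span F {z}) := by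
    rw [Submodule.disjoint_span_singleton' hz0]
    exact hz
  obtain ⟨W, hwW, hW⟩ := hd.exists_isCompl
  have hdim := Submodule.finrank_add_eq_of_isCompl hW
  rw [finrank_span_singleton hz0] at hdim
  obtain ⟨K, h1, h2, h3⟩ := exists_between_finrank_eq hwW (k := k)
    (by rw [finrank_span_singleton hw]; exact hk) (by omega)
  refine ⟨K, h1 (Submodule.mem_span_singleton_self w), fun h => ?_, h3⟩
  exact hz0 (Submodule.disjoint_def.1 hW.disjoint z (h2 h) (Submodule.mem_span_singleton_self z))

/-- A nonzero vector of `K` can be put at any prescribed place of a tuple spanning `K`. -/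
theorem exists_span_range_eq {ι : Type*} [Fintype ι] {K : Submodule F E}
    (hK : Module.finrank F K ≤ Fintype.card ι) {w : E} (hw : w ∈ K) (hw0 : w ≠ 0) (j : ι) :
    ∃ v : ι → E, v j = w ∧ Submodule.span F (Set.range v) = K := by
  classical
  obtain ⟨b, hbK, hwb, hKb, hb⟩ := exists_linearIndepOn_id_extension
    (K := F) (s := {w}) (t := (K : Set E)) (LinearIndepOn.singleton (v := id) hw0)
    (Set.singleton_subset_iff.2 hw)
  have hspan : Submodule.span F b = K := le_antisymm (Submodule.span_le.2 hbK) hKb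
  have hfin : b.Finite := hb.setFinite
  have : Fintype b := hfin.fintype
  have hcard : Fintype.card b ≤ Fintype.card ι := by
    rw [← hspan, finrank_span_set_eq_card hb, Set.toFinset_card] at hK
    exact hK
  obtain ⟨f⟩ := Function.Embedding.nonempty_of_card_le hcard
  let w' : b := ⟨w, hwb rfl⟩
  -- The swap moves the place of `w` to `j`; unused places are later filled with zeros.
  let g : b → ι := fun x => Equiv.swap (f w') j (f x)
  have hg : Function.Injective g := (Equiv.injective _).comp f.injective
  refine ⟨Function.extend g Subtype.val 0, ?_, ?_⟩
  · have : g w' = j := Equiv.swap_apply_left _ _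
    rw [← this, hg.extend_apply]
  · refine le_antisymm (Submodule.span_le.2 ?_) ?_
    · rintro _ ⟨i, rfl⟩
      by_cases hi : ∃ x, g x = i
      · obtain ⟨x, rfl⟩ := hi
        rw [hg.extend_apply]
        exact hbK x.2
      · rw [Function.extend_apply' _ _ _ hi]
        exact K.zero_mem
    · rw [← hspan]
      refine Submodule.span_mono fun x hx => ⟨g ⟨x, hx⟩, ?_⟩
      rw [hg.extend_apply]

/-- The tuples spanning `K` span the space of all tuples in `K`. -/
theorem mem_of_forall_span_range_eq {ι : Type*} [Fintype ι] {K : Submodule F E}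
    (hK : Module.finrank F K ≤ Fintype.card ι) {S : Submodule F (ι → E)}
    (hS : ∀ v : ι → E, Submodule.span F (Set.range v) = K → v ∈ S)
    {v : ι → E} (hv : ∀ i, v i ∈ K) : v ∈ S := by
  classical
  suffices h : ∀ i, ∀ w ∈ K, Pi.single i w ∈ S by
    rw [← Finset.univ_sum_single v]
    exact S.sum_mem fun i _ => h i _ (hv i)
  intro i w hw
  by_cases hw0 : w = 0
  · rw [hw0, Pi.single_zero]
    exact S.zero_mem
  by_cases hj : ∃ j, j ≠ i
  · obtain ⟨j, hj⟩ := hj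
    -- With `w` stored at `j ≠ i`, adding `w` at `i` does not change the span, so `Pi.single i w` is
    -- a difference of two tuples spanning `K`.
    obtain ⟨u, huj, hu⟩ := exists_span_range_eq hK hw hw0 j
    have huK : ∀ l, u l ∈ K := fun l => hu ▸ Submodule.subset_span ⟨l, rfl⟩
    have h2 : Submodule.span F (Set.range (u + Pi.single i w)) = K := by
      refine le_antisymm (Submodule.span_le.2 ?_) ?_
      · rintro _ ⟨l, rfl⟩
        refine K.add_mem (huK l) ?_
        by_cases hl : l = i
        · rw [hl, Pi.single_eq_same]; exact hw
        · rw [Pi.single_eq_of_ne hl]; exact K.zero_mem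
      · conv_lhs => rw [← hu]
        refine Submodule.span_le.2 ?_
        have hwm : w ∈ Submodule.span F (Set.range (u + Pi.single i w)) :=
          Submodule.subset_span ⟨j, by simp [huj, hj]⟩
        rintro _ ⟨l, rfl⟩
        have hl : (u + Pi.single i w : ι → E) l ∈ Submodule.span F (Set.range (u + Pi.single i w)) :=
          Submodule.subset_span ⟨l, rfl⟩
        by_cases hli : l = i
        · subst hli
          have := Submodule.sub_mem _ hl hwm
          simpa using this
        · simpa [hli] using hl
    have := S.sub_mem (hS _ h2) (hS _ hu)
    simpa using this
  · push Not at hj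
    obtain ⟨u, hui, hu⟩ := exists_span_range_eq hK hw hw0 i
    have : Pi.single i w = u := by
      ext l
      rw [hj l, Pi.single_eq_same, hui]
    rw [this]
    exact hS _ hu

theorem exists_smul_of_forall_mem_span (f : E →ₗ[F] E)
    (h : ∀ w, f w ∈ Submodule.span F {w}) : ∃ c : F, ∀ w, f w = c • w := by
  obtain ⟨c, hc⟩ := LinearMap.exists_eq_smul_id_of_forall_notLinearIndependent (f := f)
    (fun v hv => by
      rw [linearIndependent_fin2] at hv
      obtain ⟨a, ha⟩ := Submodule.mem_span_singleton.1 (h v)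
      by_cases ha0 : a = 0
      · exact hv.1 (by simp [← ha, ha0])
      · exact hv.2 a⁻¹ (by simp [← ha, smul_smul, ha0]))
  exact ⟨c, fun w => by rw [hc]; rfl⟩

end LinearAlgebra

/-! ### Leading spaces and independent transversals. -/

section TupleSpaces

variable {F : Type*} [Field F] {E : Type*} [AddCommGroup E] [Module F E] {n : ℕ}

/-- The tuples of `A` whose entries before position `q` vanish. -/
def tailSpace (A : Submodule F (Fin n → E)) (q : ℕ) : Submodule F (Fin n → E) where
  carrier := {M | M ∈ A ∧ ∀ i : Fin n, (i : ℕ) < q → M i = 0}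
  add_mem' := fun ha hb =>
    ⟨A.add_mem ha.1 hb.1, fun i hi => by simp [ha.2 i hi, hb.2 i hi]⟩
  zero_mem' := ⟨A.zero_mem, fun _ _ => rfl⟩
  smul_mem' := fun c _ ha => ⟨A.smul_mem c ha.1, fun i hi => by simp [ha.2 i hi]⟩

/-- The entries at position `p` of the tuples of `A` that vanish before position `p`. -/
def leadSpace (A : Submodule F (Fin n → E)) (p : Fin n) : Submodule F E :=
  (tailSpace A p).map (LinearMap.proj p)

/-- The dimension of the span of the entries of a tuple. -/
noncomputable def tupleRank (F : Type*) [Field F] [Module F E] (M : Fin n → E) : ℕ :=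
  Module.finrank F (Submodule.span F (Set.range M))

theorem exists_of_mem_leadSpace {A : Submodule F (Fin n → E)} {p : Fin n} {x : E}
    (hx : x ∈ leadSpace A p) : ∃ M ∈ A, (∀ i < p, M i = 0) ∧ M p = x := by
  obtain ⟨M, hM, rfl⟩ := hx
  exact ⟨M, hM.1, fun i hi => hM.2 i hi, rfl⟩

theorem mem_leadSpace {A : Submodule F (Fin n → E)} {p : Fin n} {M : Fin n → E} (hM : M ∈ A)
    (h : ∀ i < p, M i = 0) : M p ∈ leadSpace A p :=
  ⟨M, ⟨hM, fun i hi => h i hi⟩, rfl⟩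

/-- Rank-nullity for evaluation at `p` on the tuples vanishing before `p`. -/
theorem finrank_tailSpace [FiniteDimensional F E] (A : Submodule F (Fin n → E)) (p : Fin n) :
    Module.finrank F (leadSpace A p) + Module.finrank F (tailSpace A (p + 1))
      = Module.finrank F (tailSpace A p) := by
  let f : tailSpace A p →ₗ[F] E := (LinearMap.proj p).domRestrict (tailSpace A p)
  have hr : LinearMap.range f = leadSpace A p := LinearMap.range_domRestrict _ _
  have hk : (LinearMap.ker f).map (tailSpace A p).subtype = tailSpace A (p + 1) := by
    ext M
    constructor
    · rintro ⟨⟨N, hN⟩, hN0, rfl⟩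
      refine ⟨hN.1, fun i hi => ?_⟩
      rcases Nat.lt_succ_iff_lt_or_eq.1 hi with h | h
      · exact hN.2 i h
      · rw [Fin.ext h]
        exact hN0
    · intro hM
      exact ⟨⟨M, hM.1, fun i hi => hM.2 i (hi.trans (Nat.lt_succ_self _))⟩,
        hM.2 p (Nat.lt_succ_self _), rfl⟩
  have := LinearMap.finrank_range_add_finrank_ker f
  rw [hr] at this
  rw [← hk, Submodule.finrank_map_subtype_eq]
  exact this

theorem sum_finrank_leadSpace [FiniteDimensional F E] (A : Submodule F (Fin n → E)) :
    ∑ p, Module.finrank F (leadSpace A p) = Module.finrank F A := by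
  have h0 : tailSpace A 0 = A := by
    ext M
    exact ⟨fun h => h.1, fun h => ⟨h, fun i hi => absurd hi (Nat.not_lt_zero _)⟩⟩
  have hn : tailSpace A n = ⊥ := by
    rw [Submodule.eq_bot_iff]
    exact fun M hM => funext fun i => hM.2 i i.2
  let g : ℕ → ℤ := fun q => Module.finrank F (tailSpace A q)
  have h1 : ∀ p : Fin n, (Module.finrank F (leadSpace A p) : ℤ) = g p - g (p + 1) := fun p => by
    have := finrank_tailSpace A p
    simp only [g]
    omega
  have h2 : ((∑ p, Module.finrank F (leadSpace A p) : ℕ) : ℤ) = Module.finrank F A := by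
    rw [Nat.cast_sum, Finset.sum_congr rfl fun p _ => h1 p,
      Fin.sum_univ_eq_sum_range (fun q => g q - g (q + 1)) n, Finset.sum_range_sub']
    change (Module.finrank F (tailSpace A 0) : ℤ) - Module.finrank F (tailSpace A n) = _
    rw [h0, hn, finrank_bot, Nat.cast_zero, sub_zero]
  exact_mod_cast h2

/-- An independent transversal of the leading spaces is realised by a tuple of `A`. -/
theorem exists_linearIndepOn_of_mem_leadSpace {A : Submodule F (Fin n → E)} {S : Finset (Fin n)}
    {u : Fin n → E} (hu : ∀ i ∈ S, u i ∈ leadSpace A i) (hi : LinearIndepOn F u (S : Set (Fin n))) :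
    ∃ M ∈ A, LinearIndepOn F M (S : Set (Fin n)) := by
  -- The entries of `u` are replaced by those of a tuple of `A` from left to right, keeping the
  -- mixed tuple independent on `S`.
  have key : ∀ q : ℕ, ∃ M ∈ A, LinearIndepOn F
      (fun i : Fin n => if (i : ℕ) < q then M i else u i) (S : Set (Fin n)) := by
    intro q
    induction q with
    | zero => exact ⟨0, A.zero_mem, by simpa using hi⟩
    | succ q ih =>
      obtain ⟨M, hM, hind⟩ := ih
      set w : Fin n → E := fun i : Fin n => if (i : ℕ) < q then M i else u i with hw
      by_cases hq : ∃ p ∈ S, (p : ℕ) = q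
      · obtain ⟨p, hp, hpq⟩ := hq
        obtain ⟨B, hB, hB0, hBp⟩ := exists_of_mem_leadSpace (hu p hp)
        have hS : (S : Set (Fin n)) = insert p ((S : Set (Fin n)) \ {p}) := by
          rw [Set.insert_sdiff_singleton, Set.insert_eq_of_mem]
          exact hp
        have hup : u p ∉ Submodule.span F (w '' ((S : Set (Fin n)) \ {p})) := by
          have := hind.notMem_span (i := p) hp
          simpa [hw, hpq] using this
        have main : ∀ N ∈ A, (∀ i < p, N i = M i) →
            N p ∉ Submodule.span F (w '' ((S : Set (Fin n)) \ {p})) →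
            ∃ M ∈ A, LinearIndepOn F
              (fun i : Fin n => if (i : ℕ) < q + 1 then M i else u i) (S : Set (Fin n)) := by
          intro N hN hNM hNp
          have hEq : Set.EqOn w (fun i : Fin n => if (i : ℕ) < q + 1 then N i else u i)
              ((S : Set (Fin n)) \ {p}) := by
            intro i hiS
            have hip : (i : ℕ) ≠ q := fun h => hiS.2 (Fin.ext (h.trans hpq.symm))
            simp only [hw]
            by_cases hlt : (i : ℕ) < q
            · rw [if_pos hlt, if_pos (hlt.trans (Nat.lt_succ_self _)),
                hNM i (Fin.lt_def.2 (hpq ▸ hlt))]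
            · rw [if_neg hlt, if_neg (by omega)]
          refine ⟨N, hN, ?_⟩
          rw [hS]
          refine ((hind.mono Set.sdiff_subset).congr hEq).insert ?_
          rw [← Set.image_congr hEq]
          simpa [hpq] using hNp
        -- If `M p` is dependent on the other entries, add a tuple with leading entry `u p`: as `u
        -- p` lies outside their span, so does `M p + u p`, and earlier entries are unchanged.
        by_cases hMp : M p ∈ Submodule.span F (w '' ((S : Set (Fin n)) \ {p}))
        · refine main (M + B) (A.add_mem hM hB) (fun i hi => by simp [hB0 i hi]) fun h => hup ?_
          have := Submodule.sub_mem _ h hMp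
          simpa [hBp] using this
        · exact main M hM (fun _ _ => rfl) hMp
      · refine ⟨M, hM, hind.congr fun i hiS => ?_⟩
        have hne : (i : ℕ) ≠ q := fun h => hq ⟨i, hiS, h⟩
        simp only [hw]
        by_cases hlt : (i : ℕ) < q
        · rw [if_pos hlt, if_pos (hlt.trans (Nat.lt_succ_self _))]
        · rw [if_neg hlt, if_neg (by omega)]
  obtain ⟨M, hM, h⟩ := key n
  exact ⟨M, hM, by simpa using h⟩

theorem card_le_tupleRank [FiniteDimensional F E] {S : Finset (Fin n)} {M : Fin n → E}
    (h : LinearIndepOn F M (S : Set (Fin n))) : S.card ≤ tupleRank F M := by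
  have h1 : Module.finrank F (Submodule.span F (Set.range fun i : (S : Set (Fin n)) => M i))
      = S.card := by
    rw [finrank_span_eq_card h]
    simp
  rw [← h1]
  refine Submodule.finrank_mono (Submodule.span_mono ?_)
  rintro _ ⟨i, rfl⟩
  exact ⟨i, rfl⟩

theorem card_le_of_mem_leadSpace [FiniteDimensional F E]
    {A : Submodule F (Fin n → E)} {r : ℕ}
    (hr : ∀ M ∈ A, tupleRank F M ≤ r) {S : Finset (Fin n)} {u : Fin n → E}
    (hu : ∀ i ∈ S, u i ∈ leadSpace A i) (hi : LinearIndepOn F u (S : Set (Fin n))) :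
    S.card ≤ r := by
  obtain ⟨M, hM, h⟩ := exists_linearIndepOn_of_mem_leadSpace hu hi
  exact (card_le_tupleRank h).trans (hr M hM)

theorem finrank_span_image_eq_card {S : Finset (Fin n)} {u : Fin n → E}
    (hi : LinearIndepOn F u (S : Set (Fin n))) :
    Module.finrank F (Submodule.span F (u '' (S : Set (Fin n)))) = S.card := by
  rw [Set.image_eq_range, finrank_span_eq_card hi]
  simp

/-- An independent transversal can be enlarged by any subspace not contained in its span. -/
theorem exists_insert_transversal {R : Fin n → Submodule F E} {S : Finset (Fin n)}
    {u : Fin n → E} (hu : ∀ i ∈ S, u i ∈ R i) (hi : LinearIndepOn F u (S : Set (Fin n)))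
    {p : Fin n} (hp : p ∉ S)
    (hR : ¬ R p ≤ Submodule.span F (u '' (S : Set (Fin n)))) :
    ∃ w : Fin n → E, (∀ i ∈ S, w i = u i) ∧ (∀ i ∈ insert p S, w i ∈ R i) ∧
      LinearIndepOn F w ((insert p S : Finset (Fin n)) : Set (Fin n)) := by
  obtain ⟨x, hx, hxs⟩ := SetLike.not_le_iff_exists.1 hR
  have hne : ∀ i ∈ S, i ≠ p := fun i hi h => hp (h ▸ hi)
  have hEq : Set.EqOn u (Function.update u p x) (S : Set (Fin n)) := fun i hi => by
    rw [Function.update_of_ne (hne i hi)]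
  refine ⟨Function.update u p x, fun i hi => (hEq hi).symm, fun i hi => ?_, ?_⟩
  · rcases Finset.mem_insert.1 hi with rfl | h
    · rw [Function.update_self]
      exact hx
    · rw [← hEq h]
      exact hu i h
  · rw [Finset.coe_insert]
    refine (hi.congr hEq).insert ?_
    rw [← Set.image_congr hEq, Function.update_self]
    exact hxs

/-- Greedy choice: reserve a space of dimension greater than `k` and find a transversal of size `k`
among the others. Its span has dimension `k` and cannot contain the reserved space. -/
theorem exists_transversal [FiniteDimensional F E] (R : Fin n → Submodule F E)
    (k : ℕ) (T : Finset (Fin n))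
    (hT : ∀ j < k, k - j ≤ (T.filter fun i => j < Module.finrank F (R i)).card) :
    ∃ S ⊆ T, S.card = k ∧ ∃ u : Fin n → E, (∀ i ∈ S, u i ∈ R i) ∧
      LinearIndepOn F u (S : Set (Fin n)) := by
  induction k generalizing T with
  | zero =>
    exact ⟨∅, Finset.empty_subset _, rfl, 0, by simp, by simp [linearIndepOn_empty]⟩
  | succ k ih =>
    have h1 := hT k (Nat.lt_succ_self k)
    obtain ⟨p, hp⟩ := Finset.card_pos.1 (show 0 < (T.filter fun i =>
      k < Module.finrank F (R i)).card by omega)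
    obtain ⟨hpT, hpk⟩ := Finset.mem_filter.1 hp
    obtain ⟨S, hS, hcard, u, hu, hi⟩ := ih (T.erase p) (fun j hj => by
      have h2 := hT j (by omega)
      rw [Finset.filter_erase]
      have h3 := Finset.pred_card_le_card_erase
        (s := T.filter fun i => j < Module.finrank F (R i)) (a := p)
      omega)
    have hpS : p ∉ S := fun h => by simpa using hS h
    obtain ⟨w, -, hw, hwi⟩ := exists_insert_transversal hu hi hpS (fun h => by
      have := Submodule.finrank_mono h
      rw [finrank_span_image_eq_card hi] at this
      omega)
    refine ⟨insert p S, ?_, by rw [Finset.card_insert_of_notMem hpS, hcard], w, hw, hwi⟩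
    intro i hi
    rcases Finset.mem_insert.1 hi with rfl | h
    · exact hpT
    · exact Finset.mem_of_mem_erase (hS h)

end TupleSpaces

/-! ### Arithmetic of the dimension sequence. -/

theorem sum_le_of_card_filter_le {ι : Type*} [Fintype ι] {d : ι → ℕ} {m t c : ℕ}
    (hd : ∀ i, d i ≤ m) (htm : t ≤ m) (hc : (Finset.univ.filter fun i => t < d i).card ≤ c) :
    ∑ i, d i ≤ Fintype.card ι * t + c * (m - t) := by
  have h : ∀ i, d i ≤ t + if t < d i then m - t else 0 := by
    intro i
    have := hd i
    split_ifs <;> omega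
  refine (Finset.sum_le_sum fun i _ => h i).trans ?_
  rw [Finset.sum_add_distrib, Finset.sum_const, Finset.card_univ, smul_eq_mul, ← Finset.sum_filter,
    Finset.sum_const, smul_eq_mul]
  exact Nat.add_le_add_left (Nat.mul_le_mul_right _ hc) _

/-- A list of `n` numbers at most `m ≤ n` with sum `r * n` and few large entries is constant, or
consists of `r` entries `m` and of zeros. -/
theorem eq_of_sum_eq_mul {n m r t : ℕ} {d : Fin n → ℕ} (hn : 0 < n) (hmn : m ≤ n)
    (hd : ∀ i, d i ≤ m) (hsum : ∑ i, d i = r * n) (htr : t ≤ r)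
    (ht : (Finset.univ.filter fun i => t < d i).card ≤ r - t) :
    (∀ i, d i = r) ∨ (m = n ∧ (Finset.univ.filter fun i => 0 < d i).card = r ∧
      ∀ i, 0 < d i → d i = m) := by
  have hrm : r ≤ m := by
    have h1 : ∑ i, d i ≤ n * m := by
      refine (Finset.sum_le_sum fun i _ => hd i).trans ?_
      simp
    rw [hsum, mul_comm n m] at h1
    exact Nat.le_of_mul_le_mul_right h1 hn
  have h := sum_le_of_card_filter_le hd (htr.trans hrm) ht
  rw [hsum, Fintype.card_fin] at h
  -- The bound `r * n ≤ n * t + (r - t) * (m - t)` amounts to `(r - t) * (n - m + t) ≤ 0`.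
  have ht0 : t = r ∨ t = 0 := by
    obtain ⟨a, rfl⟩ := Nat.exists_eq_add_of_le htr
    obtain ⟨b, rfl⟩ := Nat.exists_eq_add_of_le (htr.trans hrm)
    obtain ⟨c, rfl⟩ := Nat.exists_eq_add_of_le hmn
    simp only [Nat.add_sub_cancel_left] at h
    have h2 : a * t ≤ 0 := by nlinarith [Nat.zero_le (a * c)]
    rcases Nat.mul_eq_zero.1 (Nat.le_zero.1 h2) with h3 | h3 <;> omega
  have hconst : t = r → ∀ i, d i = r := by
    rintro rfl
    rw [Nat.sub_self, Nat.le_zero, Finset.card_eq_zero, Finset.filter_eq_empty_iff] at ht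
    have hle : ∀ i ∈ Finset.univ, d i ≤ t := fun i hi => not_lt.1 (ht hi)
    have := (Finset.sum_eq_sum_iff_of_le hle).1 (by rw [hsum]; simp [mul_comm])
    exact fun i => this i (Finset.mem_univ i)
  by_cases hr : r = 0
  · exact Or.inl (hconst (by omega))
  rcases ht0 with h0 | rfl
  · exact Or.inl (hconst h0)
  right
  simp only [Nat.sub_zero, mul_zero, zero_add] at h ht
  have hmn' : m = n := le_antisymm hmn (Nat.le_of_mul_le_mul_left h (Nat.pos_of_ne_zero hr))
  subst hmn'
  have hs : ∑ i ∈ Finset.univ.filter (fun i => 0 < d i), d i = r * m := by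
    rw [← hsum, Finset.sum_filter]
    refine Finset.sum_congr rfl fun i _ => ?_
    split_ifs <;> omega
  have hs2 : ∑ i ∈ Finset.univ.filter (fun i => 0 < d i), d i
      ≤ ∑ i ∈ Finset.univ.filter (fun i => 0 < d i), m := Finset.sum_le_sum fun i _ => hd i
  have hs3 := hs2
  rw [hs, Finset.sum_const, smul_eq_mul] at hs3
  have hcard := le_antisymm ht (Nat.le_of_mul_le_mul_right hs3 hn)
  refine ⟨rfl, hcard, fun i hi => ?_⟩
  have := (Finset.sum_eq_sum_iff_of_le
    (s := Finset.univ.filter (fun i => 0 < d i)) (fun i _ => hd i)).1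
    (by rw [hs, Finset.sum_const, hcard, smul_eq_mul])
  exact this i (by simpa using hi)

/-! ### The two extremal configurations of leading spaces, and growth of the rank. -/

section TupleSpaces

variable {F : Type*} [Field F] {E : Type*} [AddCommGroup E] [Module F E]
  {n r : ℕ} {A : Submodule F (Fin n → E)}

/-- Tuples of `A` can be modified from position `p` on so as to avoid a given subspace there. -/
theorem exists_notMem_of_not_leadSpace_le {M : Fin n → E} (hM : M ∈ A) {p : Fin n}
    {W : Submodule F E} (hW : ¬ leadSpace A p ≤ W) :
    ∃ N ∈ A, (∀ i < p, N i = M i) ∧ N p ∉ W := by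
  by_cases hMp : M p ∈ W
  · obtain ⟨x, hx, hxW⟩ := SetLike.not_le_iff_exists.1 hW
    obtain ⟨B, hB, hB0, rfl⟩ := exists_of_mem_leadSpace hx
    refine ⟨M + B, A.add_mem hM hB, fun i hi => by simp [hB0 i hi], fun h => hxW ?_⟩
    simpa using W.sub_mem h hMp
  · exact ⟨M, hM, fun _ _ => rfl, hMp⟩

/-- Entries at positions where all entries belong to the leading spaces can be prescribed. -/
theorem exists_forall_eq {J : Finset (Fin n)} (hJ : ∀ j ∈ J, ∀ M ∈ A, M j ∈ leadSpace A j)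
    {v : Fin n → E} (hv : ∀ j ∈ J, v j ∈ leadSpace A j) : ∃ M ∈ A, ∀ j ∈ J, M j = v j := by
  have key : ∀ q : ℕ, ∃ M ∈ A, ∀ j ∈ J, (j : ℕ) < q → M j = v j := by
    intro q
    induction q with
    | zero => exact ⟨0, A.zero_mem, fun j _ hj => absurd hj (Nat.not_lt_zero _)⟩
    | succ q ih =>
      obtain ⟨M, hM, h⟩ := ih
      by_cases hq : ∃ p ∈ J, (p : ℕ) = q
      · obtain ⟨p, hp, rfl⟩ := hq
        obtain ⟨B, hB, hB0, hBp⟩ :=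
          exists_of_mem_leadSpace (Submodule.sub_mem _ (hv p hp) (hJ p hp M hM))
        refine ⟨M + B, A.add_mem hM hB, fun j hj hjp => ?_⟩
        rcases Nat.lt_succ_iff_lt_or_eq.1 hjp with hlt | heq
        · rw [Pi.add_apply, hB0 j hlt, add_zero, h j hj hlt]
        · rw [Fin.ext heq, Pi.add_apply, hBp, add_sub_cancel]
      · refine ⟨M, hM, fun j hj hjq => ?_⟩
        rcases Nat.lt_succ_iff_lt_or_eq.1 hjq with hlt | heq
        · exact h j hj hlt
        · exact absurd ⟨j, hj, heq⟩ hq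
  obtain ⟨M, hM, h⟩ := key n
  exact ⟨M, hM, fun j hj => h j hj j.2⟩

variable [FiniteDimensional F E]

theorem finrank_leadSpace_eq (hr : ∀ M ∈ A, tupleRank F M ≤ r) (hn : 0 < n)
    (hE : Module.finrank F E ≤ n) (hA : Module.finrank F A = r * n) :
    (∀ i, Module.finrank F (leadSpace A i) = r) ∨ (Module.finrank F E = n ∧
      (Finset.univ.filter fun i => 0 < Module.finrank F (leadSpace A i)).card = r ∧
      ∀ i, 0 < Module.finrank F (leadSpace A i) → leadSpace A i = ⊤) := by
  -- If no such `t` existed, `exists_transversal` would produce an independent transversal of size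
  -- `r + 1`.
  obtain ⟨t, htr, ht⟩ : ∃ t ≤ r, (Finset.univ.filter fun i =>
      t < Module.finrank F (leadSpace A i)).card ≤ r - t := by
    by_contra! h
    obtain ⟨S, -, hS, u, hu, hi⟩ := exists_transversal (leadSpace A) (r + 1) Finset.univ
      (fun j hj => by have := h j (by omega); omega)
    have := card_le_of_mem_leadSpace hr hu hi
    omega
  rcases eq_of_sum_eq_mul hn hE (fun i => Submodule.finrank_le (leadSpace A i))
    ((sum_finrank_leadSpace A).trans hA) htr ht with h | ⟨h1, h2, h3⟩
  · exact Or.inl h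
  · exact Or.inr ⟨h1, h2, fun i hi => Submodule.eq_top_of_finrank_eq (h3 i hi)⟩

/-- If all leading spaces have the maximum rank as dimension, they coincide. -/
theorem leadSpace_eq_leadSpace (hr : ∀ M ∈ A, tupleRank F M ≤ r) (hE : Module.finrank F E ≤ n)
    (h : ∀ i, Module.finrank F (leadSpace A i) = r) (a b : Fin n) :
    leadSpace A a = leadSpace A b := by
  by_contra hne
  have hrE : r ≤ Module.finrank F E := h a ▸ Submodule.finrank_le (leadSpace A a)
  have hrn : r < n := by
    refine lt_of_le_of_ne (hrE.trans hE) fun hrn => hne ?_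
    have htop : ∀ i, leadSpace A i = ⊤ := fun i =>
      Submodule.eq_top_of_finrank_eq (by rw [h i]; omega)
    rw [htop a, htop b]
  have hab : a ≠ b := fun hab => hne (hab ▸ rfl)
  obtain ⟨v, hvb, hva⟩ : ∃ v ∈ leadSpace A b, v ∉ leadSpace A a := by
    by_contra! hle
    exact hne (Submodule.eq_of_le_of_finrank_eq hle (by rw [h, h])).symm
  have hv0 : v ≠ 0 := fun hv => hva (hv ▸ zero_mem _)
  have hr0 : 1 ≤ r := by
    rw [← h b]
    exact Submodule.one_le_finrank_iff.2 fun hb => hv0 (by simpa [hb] using hvb)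
  -- A transversal through `v` at `b` grows to size `r` while avoiding position `a`, which is
  -- possible since `r < n`.
  have key : ∀ k, 1 ≤ k → k ≤ r → ∃ (S : Finset (Fin n)) (u : Fin n → E), S.card = k ∧ a ∉ S ∧
      b ∈ S ∧ u b = v ∧ (∀ i ∈ S, u i ∈ leadSpace A i) ∧
      LinearIndepOn F u (S : Set (Fin n)) := by
    intro k hk
    induction k, hk using Nat.le_induction with
    | base =>
      intro _
      refine ⟨{b}, fun _ => v, by simp, by simpa using hab, by simp, rfl, ?_, ?_⟩
      · intro i hi
        rw [Finset.mem_singleton.1 hi]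
        exact hvb
      · rw [Finset.coe_singleton]
        exact LinearIndepOn.singleton hv0
    | succ k hk ih =>
      intro hkr
      obtain ⟨S, u, hS, haS, hbS, hub, hu, hi⟩ := ih (by omega)
      obtain ⟨p, hp⟩ : ∃ p, p ∉ insert a S := by
        by_contra! hall
        have h1 := Finset.card_le_card (show Finset.univ ⊆ insert a S from fun i _ => hall i)
        rw [Finset.card_insert_of_notMem haS, hS, Finset.card_univ, Fintype.card_fin] at h1
        omega
      rw [Finset.mem_insert, not_or] at hp
      obtain ⟨w, hwu, hw, hwi⟩ := exists_insert_transversal hu hi hp.2 (fun hle => by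
        have := Submodule.finrank_mono hle
        rw [finrank_span_image_eq_card hi, h p] at this
        omega)
      refine ⟨insert p S, w, by rw [Finset.card_insert_of_notMem hp.2, hS], ?_,
        Finset.mem_insert_of_mem hbS, by rw [hwu b hbS, hub], hw, hwi⟩
      rw [Finset.mem_insert, not_or]
      exact ⟨fun h => hp.1 h.symm, haS⟩
  obtain ⟨S, u, hS, haS, hbS, hub, hu, hi⟩ := key r hr0 le_rfl
  -- The span has dimension `r` and contains `v`, so it is not the leading space at `a`; position
  -- `a` can thus be added, giving size `r + 1`.
  obtain ⟨w, -, hw, hwi⟩ := exists_insert_transversal hu hi haS (fun hle => by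
    have heq := Submodule.eq_of_le_of_finrank_eq hle
      (by rw [finrank_span_image_eq_card hi, h a, hS])
    refine hva ?_
    rw [heq, ← hub]
    exact Submodule.subset_span ⟨b, hbS, rfl⟩)
  have := card_le_of_mem_leadSpace hr hw hwi
  rw [Finset.card_insert_of_notMem haS, hS] at this
  omega

/-- A tuple whose entries up to position `p` have rank at least `a` can be modified after
position `p` so that every position of `I` after `p` contributes to the rank. -/
theorem exists_le_tupleRank {I : Finset (Fin n)} {M : Fin n → E} (hM : M ∈ A) {p : Fin n} {a : ℕ}
    (ha : a ≤ Module.finrank F (Submodule.span F (M '' Set.Iic p)))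
    (hI : ∀ q ∈ I, p < q → ∀ W : Submodule F E, M p ∈ W → Module.finrank F W ≤ r →
      ¬ leadSpace A q ≤ W) :
    ∃ N ∈ A, min (r + 1) (a + (I.filter fun q => p < q).card) ≤ tupleRank F N := by
  -- Keeping `N p = M p` ensures that the span `W` so far contains `M p`, so `hI` applies as long as
  -- `W` has dimension at most `r`. Beyond that the cap `r + 1` is already reached.
  have key : ∀ q : ℕ, (p : ℕ) < q → ∃ N ∈ A, N p = M p ∧
      min (r + 1) (a + (I.filter fun i => p < i ∧ (i : ℕ) < q).card)
        ≤ Module.finrank F (Submodule.span F (N '' {i : Fin n | (i : ℕ) < q})) := by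
    intro q hq
    induction q, (show (p : ℕ) + 1 ≤ q from hq) using Nat.le_induction with
    | base =>
      refine ⟨M, hM, rfl, ?_⟩
      have h1 : (I.filter fun i => p < i ∧ (i : ℕ) < p + 1) = ∅ := by
        rw [Finset.filter_eq_empty_iff]
        rintro i - ⟨h2, h3⟩
        rw [Fin.lt_def] at h2
        omega
      have h2 : {i : Fin n | (i : ℕ) < p + 1} = Set.Iic p := by
        ext i
        simp only [Set.mem_ofPred_eq, Set.mem_Iic, Fin.le_def]
        omega
      rw [h1, h2, Finset.card_empty, add_zero]
      exact (min_le_right _ _).trans ha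
    | succ q hq' ih =>
      obtain ⟨N, hN, hNp, hr⟩ := ih hq'
      set W := Submodule.span F (N '' {i : Fin n | (i : ℕ) < q}) with hW
      have hmono : ∀ N' : Fin n → E, (∀ i : Fin n, (i : ℕ) < q → N' i = N i) →
          W ≤ Submodule.span F (N' '' {i : Fin n | (i : ℕ) < q + 1}) := by
        intro N' hN'
        refine Submodule.span_mono ?_
        rintro _ ⟨i, hi, rfl⟩
        exact ⟨i, Nat.lt_succ_of_lt hi, hN' i hi⟩
      by_cases hs : ∃ s ∈ I, (s : ℕ) = q
      · obtain ⟨s, hsI, rfl⟩ := hs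
        have hcard : (I.filter fun i => p < i ∧ (i : ℕ) < s + 1).card
            ≤ (I.filter fun i => p < i ∧ (i : ℕ) < s).card + 1 := by
          rw [← Finset.card_insert_of_notMem (a := s)
            (s := I.filter fun i => p < i ∧ (i : ℕ) < s) (by simp)]
          refine Finset.card_le_card fun i hi => ?_
          simp only [Finset.mem_filter, Finset.mem_insert] at hi ⊢
          rcases Nat.lt_succ_iff_lt_or_eq.1 hi.2.2 with h | h
          · exact Or.inr ⟨hi.1, hi.2.1, h⟩
          · exact Or.inl (Fin.ext h)
        by_cases hWr : Module.finrank F W ≤ r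
        · have hps : p < s := Fin.lt_def.2 hq'
          have hMW : M p ∈ W := hNp ▸ Submodule.subset_span ⟨p, hq', rfl⟩
          obtain ⟨N', hN', hNN', hs'⟩ :=
            exists_notMem_of_not_leadSpace_le hN (hI s hsI hps W hMW hWr)
          refine ⟨N', hN', (hNN' p hps).trans hNp, ?_⟩
          have hle : W ⊔ Submodule.span F {N' s}
              ≤ Submodule.span F (N' '' {i : Fin n | (i : ℕ) < s + 1}) := by
            refine sup_le (hmono N' fun i hi => hNN' i hi) ?_
            rw [Submodule.span_singleton_le_iff_mem]
            exact Submodule.subset_span ⟨s, Nat.lt_succ_self _, rfl⟩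
          have := Submodule.finrank_mono hle
          rw [Submodule.finrank_sup_span_singleton hs'] at this
          omega
        · refine ⟨N, hN, hNp, ?_⟩
          have := Submodule.finrank_mono (hmono N fun _ _ => rfl)
          omega
      · refine ⟨N, hN, hNp, le_trans ?_ (hr.trans
          (Submodule.finrank_mono (hmono N fun _ _ => rfl)))⟩
        refine min_le_min le_rfl (Nat.add_le_add_left (Finset.card_le_card fun i hi => ?_) _)
        simp only [Finset.mem_filter] at hi ⊢
        refine ⟨hi.1, hi.2.1, lt_of_le_of_ne (Nat.lt_succ_iff.1 hi.2.2) fun h => hs ⟨i, hi.1, h⟩⟩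
  obtain ⟨N, hN, -, h⟩ := key n p.2
  have huniv : {i : Fin n | (i : ℕ) < n} = Set.univ := Set.eq_univ_of_forall fun i => i.2
  rw [huniv, Set.image_univ] at h
  simp only [Fin.is_lt, and_true] at h
  exact ⟨N, hN, h⟩

end TupleSpaces

/-! ### The structure of spaces attaining the rank bound. -/

section TupleSpaces

variable {F : Type*} [Field F] {E : Type*} [AddCommGroup E] [Module F E] [FiniteDimensional F E]
  {n r : ℕ} {A : Submodule F (Fin n → E)}

/-- If the entry at `p` lies in `L` for all tuples of `A` whose entries at `J` span `K`, then every
tuple in `K` indexed by `J` extends to a tuple of `A` with the entry at `p` in `L`. -/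
theorem exists_extension_of_forall_span_eq {J : Finset (Fin n)} {p : Fin n}
    {K L : Submodule F E} (hJ : ∀ j ∈ J, ∀ M ∈ A, M j ∈ leadSpace A j)
    (hK : ∀ j ∈ J, K ≤ leadSpace A j) (hKJ : Module.finrank F K ≤ J.card)
    (h : ∀ M ∈ A, Submodule.span F (M '' (J : Set (Fin n))) = K → M p ∈ L)
    {v : J → E} (hv : ∀ j, v j ∈ K) :
    v ∈ (A ⊓ L.comap (LinearMap.proj p)).map
      (LinearMap.funLeft F E (Subtype.val : J → Fin n)) := by
  refine mem_of_forall_span_range_eq (K := K) (by simpa using hKJ) (fun u hu => ?_) hv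
  have huK : ∀ j, u j ∈ K := fun j => hu ▸ Submodule.subset_span ⟨j, rfl⟩
  obtain ⟨M, hM, hMu⟩ := exists_forall_eq hJ
    (v := fun i => if hi : i ∈ J then u ⟨i, hi⟩ else 0) (fun j hj => by
      simp only [hj, dif_pos]
      exact hK j hj (huK _))
  have hres : LinearMap.funLeft F E (Subtype.val : J → Fin n) M = u := by
    ext j
    have := hMu j j.2
    simpa using this
  refine ⟨M, ⟨hM, h M hM ?_⟩, hres⟩
  rw [← hu, ← hres, Set.image_eq_range]
  rfl

theorem lt_finrank_span_image_Iic {M : Fin n → E} {p : Fin n} {J : Finset (Fin n)}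
    (hJ : ∀ j ∈ J, j < p) (hp : M p ∉ Submodule.span F (M '' (J : Set (Fin n)))) :
    Module.finrank F (Submodule.span F (M '' (J : Set (Fin n)))) + 1
      ≤ Module.finrank F (Submodule.span F (M '' Set.Iic p)) := by
  rw [← Submodule.finrank_sup_span_singleton hp]
  refine Submodule.finrank_mono (sup_le (Submodule.span_mono (Set.image_mono fun j hj =>
    (hJ j hj).le)) ?_)
  rw [Submodule.span_singleton_le_iff_mem]
  exact Submodule.subset_span ⟨p, Set.mem_Iic.2 le_rfl, rfl⟩

/-- If all leading spaces are equal to `V`, of dimension the maximum rank, then all entries of all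
tuples belong to `V`. -/
theorem mem_of_forall_leadSpace_eq (hr : ∀ M ∈ A, tupleRank F M ≤ r) (hrn : r < n)
    {V : Submodule F E} (hV : Module.finrank F V = r) (h : ∀ i, leadSpace A i = V)
    (p : Fin n) : ∀ M ∈ A, M p ∈ V := by
  induction p using WellFoundedLT.induction with
  | ind p ih =>
  intro M₀ hM₀
  have hM₀J : LinearMap.funLeft F E (Subtype.val : Finset.Iio p → Fin n) M₀ ∈
      (A ⊓ V.comap (LinearMap.proj p)).map
        (LinearMap.funLeft F E (Subtype.val : Finset.Iio p → Fin n)) := by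
    rw [← Finset.univ_sum_single (LinearMap.funLeft F E _ M₀)]
    refine Submodule.sum_mem _ fun j _ => ?_
    have hjp : (j : Fin n) < p := Finset.mem_Iio.1 j.2
    have hwV : M₀ j ∈ V := ih j hjp M₀ hM₀
    have hwV' := (Submodule.span_singleton_le_iff_mem (M₀ j) V).2 hwV
    have h1 := finrank_span_le_card (R := F) ({M₀ j} : Set E)
    rw [Set.toFinset_singleton, Finset.card_singleton] at h1
    have h2 := Submodule.finrank_mono hwV'
    have hp0 : 1 ≤ (p : ℕ) := Nat.one_le_of_lt (Fin.lt_def.1 hjp)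
    -- The largest dimension in `V` that the `p` entries before position `p` can span.
    obtain ⟨K, hwK, hKV, hK⟩ := exists_between_finrank_eq hwV' (k := min p r)
      (le_min (h1.trans hp0) (h2.trans hV.le)) ((min_le_right _ _).trans hV.ge)
    rw [Submodule.span_singleton_le_iff_mem] at hwK
    refine exists_extension_of_forall_span_eq (K := K) (L := V)
      (fun j hj M hM => h j ▸ ih j (Finset.mem_Iio.1 hj) M hM) (fun j _ => h j ▸ hKV)
      (by rw [hK, Fin.card_Iio]; exact min_le_left _ _) (fun M hM hMK => ?_) (fun l => ?_)
    · by_contra hMp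
      -- An entry outside `V` gives rank at least `min p r + 1` up to `p`. No later leading space
      -- lies in a span of dimension at most `r` containing `M p`, since that span would equal `V`.
      -- The `n - 1 - p` later positions then lift the rank to `r + 1`.
      have ha := lt_finrank_span_image_Iic (M := M) (p := p) (J := Finset.Iio p)
        (fun j hj => Finset.mem_Iio.1 hj) (by rw [hMK]; exact fun hm => hMp (hKV hm))
      rw [hMK, hK] at ha
      obtain ⟨N, hN, hNr⟩ := exists_le_tupleRank (r := r) (I := Finset.univ) hM ha
        (fun q _ _ W hW hWr hle => hMp (by
          rw [h q] at hle
          rwa [Submodule.eq_of_le_of_finrank_le hle (by omega)]))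
      have h3 : (Finset.univ.filter fun q => p < q).card = n - 1 - p := by
        rw [← Fin.card_Ioi]
        congr 1
        ext q
        simp
      have := hr N hN
      have := p.2
      omega
    · by_cases hl : l = j
      · subst hl
        rw [Pi.single_eq_same]
        exact hwK
      · rw [Pi.single_eq_of_ne hl]
        exact K.zero_mem
  obtain ⟨M, ⟨hM, hMp⟩, hMM₀⟩ := hM₀J
  -- `M` agrees with `M₀` before `p` and has its entry at `p` in `V`.
  have h4 : (M₀ - M) p ∈ leadSpace A p := mem_leadSpace (A.sub_mem hM₀ hM) fun i hi => by
    have := congrFun hMM₀ ⟨i, Finset.mem_Iio.2 hi⟩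
    simp only [LinearMap.funLeft_apply] at this
    rw [Pi.sub_apply, this, sub_self]
  rw [h p] at h4
  have := V.add_mem h4 hMp
  simpa using this

/-- If `r` of the leading spaces are everything and the others are zero, then the entries at the
latter positions are fixed linear combinations of the entries at the former ones. -/
theorem exists_coeff_of_leadSpace_eq_top_or_bot (hr : ∀ M ∈ A, tupleRank F M ≤ r)
    (hE : Module.finrank F E = n) {I : Finset (Fin n)} (hI : I.card = r)
    (htop : ∀ i ∈ I, leadSpace A i = ⊤) (hbot : ∀ i ∉ I, leadSpace A i = ⊥) (p : Fin n) :
    ∃ c : Fin n → F, ∀ M ∈ A, M p = ∑ j ∈ I, c j • M j := by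
  classical
  by_cases hpI : p ∈ I
  · refine ⟨Pi.single p 1, fun M _ => ?_⟩
    rw [Finset.sum_eq_single p (fun j _ hj => by rw [Pi.single_eq_of_ne hj, zero_smul])
      (fun hp => absurd hpI hp), Pi.single_eq_same, one_smul]
  have hrn : r < n := by
    rw [← hI]
    have := Finset.card_lt_univ_of_notMem hpI
    rwa [Fintype.card_fin] at this
  set J := I.filter fun j => j < p
  have hJlt : ∀ j ∈ J, j < p := fun j hj => (Finset.mem_filter.1 hj).2
  have hJI : J ⊆ I := Finset.filter_subset _ _
  have hJtop : ∀ j ∈ J, leadSpace A j = ⊤ := fun j hj => htop j (hJI hj)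
  have hJcard : J.card + (I.filter fun q => p < q).card = r := by
    rw [← hI, ← Finset.card_filter_add_card_filter_not (s := I) (fun j => j < p)]
    congr 2
    refine Finset.filter_congr fun q hq => ?_
    rw [not_lt]
    exact ⟨le_of_lt, fun hle => lt_of_le_of_ne hle fun heq => hpI (heq ▸ hq)⟩
  -- Zero leading spaces outside `I` force the vanishing position by position. Hence the entry at
  -- `p` is a linear function of the entries at `J`.
  have hzero : ∀ M ∈ A, (∀ j ∈ J, M j = 0) → M p = 0 := by
    intro M hM hMJ
    have : ∀ i, i ≤ p → M i = 0 := by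
      intro i
      induction i using WellFoundedLT.induction with
      | ind i ih =>
      intro hip
      by_cases hiI : i ∈ I
      · exact hMJ i (Finset.mem_filter.2 ⟨hiI, lt_of_le_of_ne hip fun heq => hpI (heq ▸ hiI)⟩)
      · have := mem_leadSpace hM fun l hl => ih l hl (hl.le.trans hip)
        rwa [hbot i hiI, Submodule.mem_bot] at this
    exact this p le_rfl
  let f : A →ₗ[F] (J → E) := (LinearMap.funLeft F E (Subtype.val : J → Fin n)).domRestrict A
  have hf : LinearMap.range f = ⊤ := by
    rw [LinearMap.range_eq_top]
    intro u
    obtain ⟨M, hM, hMu⟩ := exists_forall_eq (A := A) (J := J)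
      (v := fun i => if hi : i ∈ J then u ⟨i, hi⟩ else 0)
      (fun j hj M _ => by rw [hJtop j hj]; trivial) (fun j hj => by rw [hJtop j hj]; trivial)
    refine ⟨⟨M, hM⟩, funext fun j => ?_⟩
    have := hMu j j.2
    simpa [f, LinearMap.funLeft_apply] using this
  obtain ⟨g, hg⟩ := f.exists_rightInverse_of_surjective hf
  have hgf : ∀ u, f (g u) = u := fun u => LinearMap.congr_fun hg u
  have huniq : ∀ M (hM : M ∈ A), M p = (g (f ⟨M, hM⟩) : Fin n → E) p := by
    intro M hM
    have h0 := hzero (M - g (f ⟨M, hM⟩)) (A.sub_mem hM (g _).2) fun j hj => by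
      have := congrFun (hgf (f ⟨M, hM⟩)) ⟨j, hj⟩
      simp only [f, LinearMap.domRestrict_apply, LinearMap.funLeft_apply] at this
      rw [Pi.sub_apply, sub_eq_zero]
      exact this.symm
    rwa [Pi.sub_apply, sub_eq_zero] at h0
  -- The contribution of the entry at `j` to the entry at `p`. It is shown to be a scalar because it
  -- preserves every line.
  let ψ : J → E →ₗ[F] E := fun j =>
    (LinearMap.proj p).comp (A.subtype.comp (g.comp (LinearMap.single F (fun _ : J => E) j)))
  have hψ : ∀ j, ∃ c : F, ∀ w, ψ j w = c • w := by
    intro j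
    refine exists_smul_of_forall_mem_span (ψ j) fun w => ?_
    by_contra hw
    have hw0 : w ≠ 0 := by
      rintro rfl
      rw [map_zero] at hw
      exact hw (zero_mem _)
    have hJ1 : 1 ≤ J.card := Finset.card_pos.2 ⟨j, j.2⟩
    have hJr : J.card ≤ r := hI ▸ Finset.card_le_card hJI
    -- Such a `K` exists because `J.card ≤ r < n = dim E`. It is contradicted once the tuple with
    -- the single entry `w` at `j` is extended with its entry at `p` in `K`.
    obtain ⟨K, hwK, hψK, hK⟩ := exists_finrank_eq_mem_notMem hw0 hw hJ1 (by omega)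
    have hmem := exists_extension_of_forall_span_eq (A := A) (J := J) (p := p) (K := K) (L := K)
      (fun j hj M _ => by rw [hJtop j hj]; trivial)
      (fun j hj => by rw [hJtop j hj]; exact le_top) hK.le (fun M hM hMK => ?_)
      (v := Pi.single j w) (fun l => ?_)
    · obtain ⟨M, ⟨hM, hMp⟩, hMw⟩ := hmem
      refine hψK ?_
      have h1 : f ⟨M, hM⟩ = Pi.single j w := hMw
      have h2 := huniq M hM
      rw [h1] at h2
      have h3 : M p ∈ K := hMp
      rw [h2] at h3
      exact h3
    · by_contra hMp
      -- Rank `J.card + 1` up to `p`, plus one for each position of `I` after `p`, makes `r + 1`.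
      have ha := lt_finrank_span_image_Iic (M := M) hJlt (by rwa [hMK])
      rw [hMK, hK] at ha
      obtain ⟨N, hN, hNr⟩ := exists_le_tupleRank (r := r) (I := I) hM ha
        (fun q hq _ W _ hWr hle => by
          rw [htop q hq] at hle
          have := Submodule.finrank_mono hle
          rw [finrank_top] at this
          omega)
      have := hr N hN
      omega
    · by_cases hl : l = j
      · subst hl
        rw [Pi.single_eq_same]
        exact hwK
      · rw [Pi.single_eq_of_ne hl]
        exact K.zero_mem
  choose c hc using hψ
  let d : Fin n → F := fun i => if hi : i ∈ J then c ⟨i, hi⟩ else 0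
  have hdJ : ∀ j : J, d j = c j := fun j => dif_pos j.2
  have hd0 : ∀ i ∉ J, d i = 0 := fun i hi => dif_neg hi
  refine ⟨d, fun M hM => ?_⟩
  have h1 : M p = ∑ j, ψ j (M j) := by
    rw [huniq M hM, ← Finset.univ_sum_single (f ⟨M, hM⟩), map_sum, AddSubmonoidClass.coe_finsetSum,
      Finset.sum_apply]
    rfl
  rw [h1, ← Finset.sum_subset hJI (fun i _ hi => by rw [hd0 i hi, zero_smul]),
    ← Finset.sum_coe_sort J fun i => d i • M i]
  exact Finset.sum_congr rfl fun j _ => by rw [hc, hdJ]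

/-- The equality case of the bound on the dimension of a space of matrices of bounded rank: either
all rows lie in a subspace of dimension `r`, or all rows are fixed linear combinations of
`r` of them. -/
theorem exists_submodule_or_coeff (hr : ∀ M ∈ A, tupleRank F M ≤ r) (hn : 0 < n)
    (hE : Module.finrank F E ≤ n) (hA : Module.finrank F A = r * n) :
    (∃ V : Submodule F E, Module.finrank F V = r ∧ ∀ M ∈ A, ∀ i, M i ∈ V) ∨
    (Module.finrank F E = n ∧ ∃ (I : Finset (Fin n)) (c : Fin n → Fin n → F), I.card = r ∧
      ∀ M ∈ A, ∀ p, M p = ∑ j ∈ I, c p j • M j) := by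
  rcases finrank_leadSpace_eq hr hn hE hA with h | ⟨h1, h2, h3⟩
  · left
    have hV := h ⟨0, hn⟩
    refine ⟨leadSpace A ⟨0, hn⟩, hV, ?_⟩
    have hrE : r ≤ Module.finrank F E := hV ▸ Submodule.finrank_le _
    -- For `r = n` the leading space is all of `E` and nothing remains to be shown.
    rcases (hrE.trans hE).lt_or_eq with hrn | hrn
    · exact fun M hM i => mem_of_forall_leadSpace_eq hr hrn hV
        (fun j => leadSpace_eq_leadSpace hr hE h j _) i M hM
    · rw [Submodule.eq_top_of_finrank_eq (S := leadSpace A ⟨0, hn⟩) (by omega)]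
      exact fun _ _ _ => trivial
  · right
    choose c hc using exists_coeff_of_leadSpace_eq_top_or_bot hr h1 h2
      (fun i hi => h3 i (Finset.mem_filter.1 hi).2)
      (fun i hi => Submodule.finrank_eq_zero.1 (by simpa using hi))
    exact ⟨h1, _, c, h2, fun M hM p => hc p M hM⟩

end TupleSpaces

/-! ### Transposition, optimal anticodes and weights. -/

section Codes

variable {F : Type*} [Field F] {n m : ℕ}

theorem mem_transposeCode {C : Submodule F (Matrix (Fin n) (Fin m) F)}
    {M : Matrix (Fin m) (Fin n) F} : M ∈ transposeCode C ↔ M.transpose ∈ C := by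
  constructor
  · rintro ⟨N, hN, rfl⟩
    exact hN
  · exact fun h => ⟨M.transpose, h, M.transpose_transpose⟩

theorem transposeCode_inf (C D : Submodule F (Matrix (Fin n) (Fin m) F)) :
    transposeCode (C ⊓ D) = transposeCode C ⊓ transposeCode D := by
  ext M
  simp only [Submodule.mem_inf, mem_transposeCode]

theorem transposeCode_transposeCode (C : Submodule F (Matrix (Fin n) (Fin m) F)) :
    transposeCode (transposeCode C) = C := by
  ext M
  simp only [mem_transposeCode, Matrix.transpose_transpose]

theorem finrank_transposeCode (C : Submodule F (Matrix (Fin n) (Fin m) F)) :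
    Module.finrank F (transposeCode C) = Module.finrank F C :=
  LinearEquiv.finrank_map_eq (Matrix.transposeLinearEquiv (Fin n) (Fin m) F F) C

theorem finrank_transposeCode_inf (C : Submodule F (Matrix (Fin n) (Fin m) F))
    (D : Submodule F (Matrix (Fin m) (Fin n) F)) :
    Module.finrank F (transposeCode C ⊓ D : Submodule F (Matrix (Fin m) (Fin n) F))
      = Module.finrank F (C ⊓ transposeCode D : Submodule F (Matrix (Fin n) (Fin m) F)) := by
  rw [← finrank_transposeCode (transposeCode C ⊓ D), transposeCode_inf, transposeCode_transposeCode]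

theorem maxRank_transposeCode (C : Submodule F (Matrix (Fin n) (Fin m) F)) :
    maxRank (transposeCode C) = maxRank C := by
  unfold maxRank
  congr 1
  ext r
  constructor
  · rintro ⟨M, hM, rfl⟩
    exact ⟨_, mem_transposeCode.1 hM, M.rank_transpose⟩
  · rintro ⟨M, hM, rfl⟩
    exact ⟨_, mem_transposeCode.2 (by rwa [M.transpose_transpose]), M.rank_transpose⟩

theorem IsOptimalAnticode.transposeCode {C : Submodule F (Matrix (Fin n) (Fin m) F)}
    (h : IsOptimalAnticode C) : IsOptimalAnticode (transposeCode C) := by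
  rw [IsOptimalAnticode, finrank_transposeCode, maxRank_transposeCode, max_comm]
  exact h

theorem mem_matColSupported {V : Submodule F (Fin n → F)} {M : Matrix (Fin n) (Fin m) F} :
    M ∈ matColSupported m V ↔ ∀ j, (fun i => M i j) ∈ V := by
  refine ⟨fun h j => h (Submodule.subset_span ⟨j, rfl⟩), fun h => Submodule.span_le.2 ?_⟩
  rintro _ ⟨j, rfl⟩
  exact h j

theorem rank_eq_finrank_colSpace (M : Matrix (Fin n) (Fin m) F) :
    M.rank = Module.finrank F (colSpace M) :=
  M.rank_eq_finrank_span_cols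

theorem finrank_matColSupported (V : Submodule F (Fin n → F)) :
    Module.finrank F (matColSupported m V) = m * Module.finrank F V := by
  let e : matColSupported m V ≃ₗ[F] (Fin m → V) :=
    { toFun := fun M j => ⟨fun i => (M : Matrix (Fin n) (Fin m) F) i j,
        mem_matColSupported.1 M.2 j⟩
      map_add' := fun _ _ => rfl
      map_smul' := fun _ _ => rfl
      invFun := fun v => ⟨Matrix.of fun i j => (v j : Fin n → F) i,
        mem_matColSupported.2 fun j => (v j).2⟩
      left_inv := fun _ => rfl
      right_inv := fun _ => rfl }
  rw [e.finrank_eq, Module.finrank_pi_fintype]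
  simp

theorem maxRank_matColSupported (hnm : n ≤ m) (V : Submodule F (Fin n → F)) :
    maxRank (matColSupported m V) = Module.finrank F V := by
  refine le_antisymm ?_ ?_
  · obtain ⟨M, hM, hr⟩ := (isGreatest_maxRank (matColSupported m V)).1
    rw [← hr, rank_eq_finrank_colSpace]
    exact Submodule.finrank_mono hM
  · by_cases hV : V = ⊥
    · rw [hV, finrank_bot]
      exact Nat.zero_le _
    have hVn : Module.finrank F V ≤ n := by simpa using Submodule.finrank_le V
    have hV1 : 1 ≤ Module.finrank F V := Submodule.one_le_finrank_iff.2 hV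
    -- Only a tuple of `m` columns spanning `V` is needed; the vector `w` and its place `0` are
    -- arbitrary.
    obtain ⟨w, hw, hw0⟩ := Submodule.exists_mem_ne_zero_of_ne_bot hV
    obtain ⟨v, -, hv⟩ := exists_span_range_eq (ι := Fin m) (K := V)
      (by rw [Fintype.card_fin]; omega) hw hw0 ⟨0, by omega⟩
    have hcol : colSpace (Matrix.of fun i j => v j i) = V := hv
    refine (isGreatest_maxRank (matColSupported m V)).2
      ⟨Matrix.of fun i j => v j i, hcol.le, ?_⟩
    rw [rank_eq_finrank_colSpace, hcol]

theorem isOptimalAnticode_matColSupported (hnm : n ≤ m) (V : Submodule F (Fin n → F)) :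
    IsOptimalAnticode (matColSupported m V) := by
  rw [IsOptimalAnticode, finrank_matColSupported, maxRank_matColSupported hnm, max_eq_right hnm]

/-- An optimal anticode is contained in a space of matrices with bounded row space or, if the
matrices are square, in a space of matrices with bounded column space. -/
theorem IsOptimalAnticode.exists_le (hn : 0 < n) (hmn : m ≤ n)
    {A : Submodule F (Matrix (Fin n) (Fin m) F)} (hA : IsOptimalAnticode A) :
    (∃ V : Submodule F (Fin m → F), Module.finrank F V ≤ maxRank A ∧
      A ≤ RankMetric.transposeCode (matColSupported n V)) ∨
    (m = n ∧ ∃ V : Submodule F (Fin n → F), Module.finrank F V ≤ maxRank A ∧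
      A ≤ matColSupported m V) := by
  let B : Submodule F (Fin n → Fin m → F) := A.map (Matrix.ofLinearEquiv F).symm.toLinearMap
  have hB : ∀ M ∈ B, Matrix.of M ∈ A := by
    rintro _ ⟨M, hM, rfl⟩
    exact hM
  have hBr : ∀ M ∈ B, tupleRank F M ≤ maxRank A := fun M hM =>
    (isGreatest_maxRank A).2 ⟨_, hB M hM, (Matrix.of M).rank_eq_finrank_span_row⟩
  have hBA : Module.finrank F B = maxRank A * n := by
    have h1 : Module.finrank F A = max n m * maxRank A := hA
    rw [max_eq_left hmn, mul_comm] at h1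
    exact (LinearEquiv.finrank_map_eq (Matrix.ofLinearEquiv F).symm A).trans h1
  rcases exists_submodule_or_coeff hBr hn (by simpa using hmn) hBA with
    ⟨V, hV, h⟩ | ⟨hmn', I, c, hI, h⟩
  · refine Or.inl ⟨V, hV.le, fun M hM => mem_transposeCode.2 (mem_matColSupported.2 fun i => ?_)⟩
    exact h (Matrix.of.symm M) ⟨M, hM, rfl⟩ i
  · refine Or.inr ⟨by simpa using hmn', ?_⟩
    -- Fixed row relations say that each column of `M` is the image under `L` of its entries in the
    -- rows of `I`.
    let L : (I → F) →ₗ[F] (Fin n → F) := (Matrix.of fun p (j : I) => c p j).mulVecLin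
    refine ⟨LinearMap.range L, ?_, fun M hM => mem_matColSupported.2 fun k =>
      ⟨fun j => M j k, funext fun p => ?_⟩⟩
    · refine (LinearMap.finrank_range_le L).trans ?_
      rw [Module.finrank_fintype_fun_eq_card, Fintype.card_coe, hI]
    · have h1 := congrFun (h (Matrix.of.symm M) ⟨M, hM, rfl⟩ p) k
      rw [← Finset.sum_coe_sort, Finset.sum_apply] at h1
      exact h1.symm

theorem genMatrixWeight_le {C : Submodule F (Matrix (Fin n) (Fin m) F)} {i : ℕ}
    {V : Submodule F (Fin n → F)} (h : i ≤ Module.finrank F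
      (C ⊓ matColSupported m V : Submodule F (Matrix (Fin n) (Fin m) F))) :
    genMatrixWeight C i ≤ Module.finrank F V :=
  Nat.sInf_le ⟨V, h, rfl⟩

theorem genWeight_eq_of_isLeast (hn : 0 < n) (hmn : m ≤ n)
    {C : Submodule F (Matrix (Fin n) (Fin m) F)} {i d : ℕ}
    (h : IsLeast (anticodeDims C i) (n * d)) : genWeight C i = d := by
  have h0 : (n : ℚ) ≠ 0 := by exact_mod_cast hn.ne'
  rw [genWeight, h.csInf_eq, max_eq_left hmn, Nat.cast_mul]
  field_simp

theorem mul_genMatrixWeight_mem_anticodeDims (hnm : n ≤ m)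
    {C : Submodule F (Matrix (Fin n) (Fin m) F)} {i : ℕ} (hi : i ≤ Module.finrank F C) :
    m * genMatrixWeight C i ∈ anticodeDims C i := by
  obtain ⟨V, hV, hVd⟩ := (isLeast_supportDims C i hi).1
  exact ⟨_, isOptimalAnticode_matColSupported hnm V, hV, by rw [finrank_matColSupported, hVd]⟩

theorem mul_genMatrixWeight_transposeCode_mem_anticodeDims (hmn : m ≤ n)
    {C : Submodule F (Matrix (Fin n) (Fin m) F)} {i : ℕ} (hi : i ≤ Module.finrank F C) :
    n * genMatrixWeight (transposeCode C) i ∈ anticodeDims C i := by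
  obtain ⟨A, hA, hAi, hAd⟩ := mul_genMatrixWeight_mem_anticodeDims hmn
    (C := transposeCode C) (i := i) (by rwa [finrank_transposeCode])
  refine ⟨transposeCode A, hA.transposeCode, ?_, by rw [finrank_transposeCode, hAd]⟩
  rwa [← finrank_transposeCode_inf]

/-- The space containing `A` from `IsOptimalAnticode.exists_le` meets `C` in at least the same
dimension, so its `V` is admissible for the matrix weight. -/
theorem genMatrixWeight_le_maxRank (hn : 0 < n) (hmn : m ≤ n)
    {C A : Submodule F (Matrix (Fin n) (Fin m) F)} {i : ℕ} (hA : IsOptimalAnticode A)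
    (hi : i ≤ Module.finrank F (C ⊓ A : Submodule F (Matrix (Fin n) (Fin m) F))) :
    genMatrixWeight (transposeCode C) i ≤ maxRank A ∨
      (m = n ∧ genMatrixWeight C i ≤ maxRank A) := by
  rcases hA.exists_le hn hmn with ⟨V, hV, hAV⟩ | ⟨h, V, hV, hAV⟩
  · refine Or.inl ((genMatrixWeight_le ?_).trans hV)
    rw [finrank_transposeCode_inf]
    exact hi.trans (Submodule.finrank_mono (inf_le_inf_left C hAV))
  · exact Or.inr ⟨h, (genMatrixWeight_le
      (hi.trans (Submodule.finrank_mono (inf_le_inf_left C hAV)))).trans hV⟩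

end Codes

end RankMetric

theorem mainTheorem4 {F : Type*} [Field F] [Finite F] {n m : ℕ} (hn : 0 < n) (hm : 0 < m)
    (C : Submodule F (Matrix (Fin n) (Fin m) F)) :
    (m < n → ∀ i : ℕ, 1 ≤ i → i ≤ Module.finrank F C →
      RankMetric.genWeight C i
        = (RankMetric.genMatrixWeight (RankMetric.transposeCode C) i : ℚ)) ∧
    (m = n → ∀ i : ℕ, 1 ≤ i → i ≤ Module.finrank F C →
      RankMetric.genWeight C i
        = ((min (RankMetric.genMatrixWeight C i)
            (RankMetric.genMatrixWeight (RankMetric.transposeCode C) i) : ℕ) : ℚ)) := by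
  refine ⟨fun hmn i _ hi => RankMetric.genWeight_eq_of_isLeast hn hmn.le
    ⟨RankMetric.mul_genMatrixWeight_transposeCode_mem_anticodeDims hmn.le hi, ?_⟩,
    fun hmn i _ hi => RankMetric.genWeight_eq_of_isLeast hn hmn.le ⟨?_, ?_⟩⟩
  · rintro _ ⟨A, hA, hAi, rfl⟩
    -- Optimality of `A` turns its dimension into `n * maxRank A`, so only maximum ranks need
    -- comparing.
    rw [show _ = _ from hA, max_eq_left hmn.le]
    refine Nat.mul_le_mul_left n ?_
    rcases RankMetric.genMatrixWeight_le_maxRank hn hmn.le hA hAi with h | h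
    · exact h
    · exact absurd h.1 hmn.ne
  · rcases min_choice (RankMetric.genMatrixWeight C i)
      (RankMetric.genMatrixWeight (RankMetric.transposeCode C) i) with h | h
    · rw [h]
      have := RankMetric.mul_genMatrixWeight_mem_anticodeDims hmn.ge hi
      -- Only the factor `m` is rewritten to `n`; the matrix sizes stay as they are.
      exact (congrArg (fun k => k * _ ∈ _) hmn).mp this
    · rw [h]
      exact RankMetric.mul_genMatrixWeight_transposeCode_mem_anticodeDims hmn.le hi
  · rintro _ ⟨A, hA, hAi, rfl⟩
    rw [show _ = _ from hA, max_eq_left hmn.le]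
    refine Nat.mul_le_mul_left n ?_
    rcases RankMetric.genMatrixWeight_le_maxRank hn hmn.le hA hAi with h | h
    · exact (min_le_right _ _).trans h
    · exact (min_le_left _ _).trans h.2
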